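/- Let $n\ge 0$ be an integer and $m=\lfloor (n+1)/2\rfloor$, so that $n=2m-1$ or $n=2m$. Let $(A_n,\{s_1,\dots,s_n\})$ be a Coxeter system of type $A_n$ (so $(s_is_{i+1})^3=e$, and $s_is_j=s_js_i$ for $|i-j|\ge 2$), and let $(B_m,\{r_1,\dots,r_m\})$ be a Coxeter system of type $B_m$ (so $(r_ir_{i+1})^3=e$ for $1\le i<m-1$, $(r_{m-1}r_m)^4=e$, and $r_ir_j=r_jr_i$ for $|i-j|\ge 2$), with length functions $\ell_A$ and $\ell_B$ with respect to these generators. Let $\phi:B_m\to A_n$ be the group homomorphism given on generators by $$\phi(r_i)=s_i\,s_{n+1-i}\quad (1\le i<m),\qquad \phi(r_m)=\begin{cases} s_m & \text{if } n=2m-1,\\ s_m s_{m+1}s_m & \text{if } n=2m.\end{cases}$$ Then $A_n$ and $B_m$ are finite, $\phi$ is injective (so it realizes $B_m$ as a folding subgroup of $A_n$), and, as polynomials in $q$ with integer coefficients, $$\sum_{(v,w)\in B_m\times B_m}(-1)^{\ell_B(w)}\,q^{\ell_B(w)+\ell_A(\phi(v))}\;=\;\sum_{(x,y)\in A_n\times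 B_m}(-1)^{\ell_A(x)}\,q^{\ell_A(x)+\ell_B(y)}.$$ -/

import Mathlib

namespace Folding

section GroupLemmas

variable {G : Type*} [Group G]

lemma mul_pow_three {a b : G} (ha : a * a = 1) (hb : b * b = 1)
    (h : (a * b) ^ 3 = 1) : a * b * a = b * a * b := by
  have ha' : a⁻¹ = a := inv_eq_of_mul_eq_one_left ha
  have hb' : b⁻¹ = b := inv_eq_of_mul_eq_one_left hb
  have h1 : (a * b * a) * (b * a * b) = 1 := by
    rw [← h]; simp only [pow_succ, pow_zero, one_mul, mul_assoc]
  rw [eq_inv_of_mul_eq_one_left h1]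
  simp only [mul_inv_rev, ha', hb', mul_assoc]

lemma pow_three_of_braid {a b : G} (ha : a * a = 1) (hb : b * b = 1)
    (h : a * b * a = b * a * b) : (a * b) ^ 3 = 1 := by
  calc (a * b) ^ 3 = (a * b * a) * (b * a * b) := by
        simp only [pow_succ, pow_zero, one_mul, mul_assoc]
    _ = (b * a * b) * (b * a * b) := by rw [h]
    _ = b * (a * ((b * b) * (a * b))) := by simp only [mul_assoc]
    _ = 1 := by rw [hb, one_mul, ← mul_assoc a, ha, one_mul, hb]

lemma commute_of_pow_two {a b : G} (ha : a * a = 1) (hb : b * b = 1)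
    (h : (a * b) ^ 2 = 1) : Commute a b := by
  have ha' : a⁻¹ = a := inv_eq_of_mul_eq_one_left ha
  have hb' : b⁻¹ = b := inv_eq_of_mul_eq_one_left hb
  have h1 : (a * b) * (a * b) = 1 := by rw [← h, pow_two]
  have h2 := eq_inv_of_mul_eq_one_left h1
  rw [mul_inv_rev, ha', hb'] at h2
  exact h2

lemma pow_swap {x y : G} {k : ℕ} (h : (x * y) ^ k = 1) : (y * x) ^ k = 1 := by
  have : y * x = x⁻¹ * (x * y) * x⁻¹⁻¹ := by group
  rw [this, conj_pow, h]; group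

lemma pow_two_of_commute {x y : G} (hx : x * x = 1) (hy : y * y = 1) (h : Commute x y) :
    (x * y) ^ 2 = 1 := by
  rw [h.mul_pow, pow_two, pow_two, hx, hy, one_mul]

/-- The Coxeter element `a c b` of a diagram `a - b - c` has order dividing `4`. -/
lemma pow_four_of_braid {a b c : G} (ha : a * a = 1) (hb : b * b = 1) (hc : c * c = 1)
    (hac : Commute a c) (hab : a * b * a = b * a * b) (hbc : b * c * b = c * b * c) :
    (a * c * b) ^ 4 = 1 := by
  have key : a * c * b * (a * c * b) = b * (a * c) * (b * (a * c)) := by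
    calc a * c * b * (a * c * b) = (a * c) * b * (a * c) * b := by simp only [mul_assoc]
      _ = (c * a) * b * (a * c) * b := by rw [hac.eq]
      _ = c * (a * b * a) * c * b := by simp only [mul_assoc]
      _ = c * (b * a * b) * c * b := by rw [hab]
      _ = c * b * a * (b * c * b) := by simp only [mul_assoc]
      _ = c * b * a * (c * b * c) := by rw [hbc]
      _ = c * b * (a * c) * b * c := by simp only [mul_assoc]
      _ = c * b * (c * a) * b * c := by rw [hac.eq]
      _ = (c * b * c) * a * b * c := by simp only [mul_assoc]
      _ = (b * c * b) * a * b * c := by rw [hbc]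
      _ = b * c * (b * a * b) * c := by simp only [mul_assoc]
      _ = b * c * (a * b * a) * c := by rw [hab]
      _ = b * (c * a) * (b * (a * c)) := by simp only [mul_assoc]
      _ = b * (a * c) * (b * (a * c)) := by rw [hac.eq]
  have hu : (a * c) * (a * c) = 1 := by
    rw [← pow_two]; exact pow_two_of_commute ha hc hac
  calc (a * c * b) ^ 4 = (a * c * b * (a * c * b)) * (a * c * b * (a * c * b)) := by
        simp only [pow_succ, pow_zero, one_mul, mul_assoc]
    _ = (b * (a * c) * (b * (a * c))) * (a * c * b * (a * c * b)) := by rw [← key]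
    _ = b * (a * c) * b * ((a * c) * (a * c)) * b * (a * c * b) := by simp only [mul_assoc]
    _ = b * (a * c) * (b * b) * (a * c) * b := by rw [hu]; simp only [mul_assoc, mul_one]
    _ = b * ((a * c) * (a * c)) * b := by rw [hb]; simp only [mul_assoc, mul_one]
    _ = 1 := by rw [hu, mul_one, hb]

/-- If `a`, `c` commute and `a - b` braid, then `a` and `c b c` braid. -/
lemma braid_conj {a b c : G} (hc : c * c = 1) (hac : Commute a c)
    (hab : a * b * a = b * a * b) :
    a * (c * b * c) * a = (c * b * c) * a * (c * b * c) := by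
  calc a * (c * b * c) * a = (a * c) * b * (c * a) := by simp only [mul_assoc]
    _ = (c * a) * b * (a * c) := by rw [hac.eq]
    _ = c * (a * b * a) * c := by simp only [mul_assoc]
    _ = c * b * a * b * c := by rw [hab]; simp only [mul_assoc]
    _ = c * b * a * (c * c) * b * c := by rw [hc, mul_one]
    _ = c * b * (a * c) * c * b * c := by simp only [mul_assoc]
    _ = c * b * (c * a) * c * b * c := by rw [hac.eq]
    _ = (c * b * c) * a * (c * b * c) := by simp only [mul_assoc]

end GroupLemmas

variable {n : ℕ} {W : Type*} [Group W]

lemma commute_simple (cs : CoxeterSystem (CoxeterMatrix.A n) W) {i j : Fin n}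
    (h : (i : ℕ) + 1 < j) : Commute (cs.simple i) (cs.simple j) := by
  apply commute_of_pow_two (by simp) (by simp)
  have := cs.simple_mul_simple_pow i j
  have hM : (CoxeterMatrix.A n) i j = 2 := by
    have h1 : i ≠ j := by rintro rfl; omega
    simp only [CoxeterMatrix.A, Matrix.of_apply]
    rw [if_neg h1, if_neg (by omega)]
  rwa [hM] at this

lemma braid_simple (cs : CoxeterSystem (CoxeterMatrix.A n) W) {i j : Fin n}
    (h : (i : ℕ) + 1 = j) :
    cs.simple i * cs.simple j * cs.simple i = cs.simple j * cs.simple i * cs.simple j := by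
  apply mul_pow_three (by simp) (by simp)
  have := cs.simple_mul_simple_pow i j
  have hM : (CoxeterMatrix.A n) i j = 3 := by
    have h1 : i ≠ j := by rintro rfl; omega
    simp only [CoxeterMatrix.A, Matrix.of_apply]
    rw [if_neg h1, if_pos (by omega)]
  rwa [hM] at this

/-- The images of the simple generators under the folding `B_m → A_n`, `m = ⌊(n+1)/2⌋`.
With `1`-based indices: `r_i ↦ s_i s_{n+1-i}` for `i < m`; the last generator is sent to
`r_m ↦ s_m` if `n = 2m - 1`, and to `r_m ↦ s_m s_{m+1} s_m` if `n = 2m`.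
(Here `Fin` is `0`-based, and `Fin.rev` is the nontrivial automorphism of the diagram `A_n`,
so `s_{m+1}` is the reverse of `s_m` when `n = 2m`.) -/
def foldingGenerator (cs : CoxeterSystem (CoxeterMatrix.A n) W) (i : Fin ((n + 1) / 2)) : W :=
  let j : Fin n := ⟨i, by have := i.isLt; omega⟩
  if (i : ℕ) + 1 < (n + 1) / 2 then cs.simple j * cs.simple j.rev
  else if Odd n then cs.simple j
  else cs.simple j * cs.simple j.rev * cs.simple j

lemma isLiftable_foldingGenerator (cs : CoxeterSystem (CoxeterMatrix.A n) W) :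
    (CoxeterMatrix.B ((n + 1) / 2)).IsLiftable (foldingGenerator cs) := by
  have sq : ∀ i, foldingGenerator cs i * foldingGenerator cs i = 1 := by
    intro i
    have hi := i.isLt
    unfold foldingGenerator
    dsimp only
    split_ifs with h1 h2
    · rw [← pow_two]
      refine pow_two_of_commute (by simp) (by simp) (commute_simple cs ?_)
      simp only [Fin.val_rev]; omega
    · simp
    · simp [mul_assoc]
  suffices H : ∀ i j : Fin ((n + 1) / 2), (i : ℕ) < j →
      (foldingGenerator cs i * foldingGenerator cs j) ^
        (CoxeterMatrix.B ((n + 1) / 2)) i j = 1 by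
    intro i j
    rcases lt_trichotomy (i : ℕ) j with h | h | h
    · exact H i j h
    · obtain rfl := Fin.ext h
      simp [sq]
    · rw [(CoxeterMatrix.B ((n + 1) / 2)).symmetric i j]
      exact pow_swap (H j i h)
  intro i j hij
  have hj := j.isLt
  have hne : i ≠ j := by rintro rfl; omega
  -- the two commuting factors of the image of `r_i`
  obtain ⟨a, ha⟩ : ∃ a : Fin n, (a : ℕ) = i := ⟨⟨i, by omega⟩, rfl⟩
  obtain ⟨b, hb⟩ : ∃ b : Fin n, (b : ℕ) = j := ⟨⟨j, by omega⟩, rfl⟩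
  have ha' : (a.rev : ℕ) = n - (i + 1) := by rw [Fin.val_rev, ha]
  have hb' : (b.rev : ℕ) = n - (j + 1) := by rw [Fin.val_rev, hb]
  have gi : foldingGenerator cs i = cs.simple a * cs.simple a.rev := by
    have e : (⟨i, by omega⟩ : Fin n) = a := Fin.ext ha.symm
    unfold foldingGenerator
    dsimp only
    rw [if_pos (by omega), e]
  have hjlt : (j : ℕ) + 1 < (n + 1) / 2 →
      foldingGenerator cs j = cs.simple b * cs.simple b.rev := by
    intro h
    have e : (⟨j, by omega⟩ : Fin n) = b := Fin.ext hb.symm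
    unfold foldingGenerator
    dsimp only
    rw [if_pos h, e]
  have hjodd : ¬ (j : ℕ) + 1 < (n + 1) / 2 → Odd n → foldingGenerator cs j = cs.simple b := by
    intro h h2
    have e : (⟨j, by omega⟩ : Fin n) = b := Fin.ext hb.symm
    unfold foldingGenerator
    dsimp only
    rw [if_neg h, if_pos h2, e]
  have hjeven : ¬ (j : ℕ) + 1 < (n + 1) / 2 → ¬ Odd n →
      foldingGenerator cs j = cs.simple b * cs.simple b.rev * cs.simple b := by
    intro h h2
    have e : (⟨j, by omega⟩ : Fin n) = b := Fin.ext hb.symm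
    unfold foldingGenerator
    dsimp only
    rw [if_neg h, if_neg h2, e]
  have caa : Commute (cs.simple a) (cs.simple a.rev) := commute_simple cs (by omega)
  by_cases adj : (i : ℕ) + 1 = j
  · by_cases last : (j : ℕ) + 1 < (n + 1) / 2
    · -- bond of order three
      have hM : (CoxeterMatrix.B ((n + 1) / 2)) i j = 3 := by
        simp only [CoxeterMatrix.B, Matrix.of_apply]
        rw [if_neg hne, if_neg (by omega), if_pos (by omega)]
      rw [hM, gi, hjlt last]
      have c1 : Commute (cs.simple a) (cs.simple b.rev) := commute_simple cs (by omega)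
      have c2 : Commute (cs.simple b) (cs.simple b.rev) := commute_simple cs (by omega)
      have c3 : Commute (cs.simple b) (cs.simple a.rev) := commute_simple cs (by omega)
      have e : cs.simple a * cs.simple a.rev * (cs.simple b * cs.simple b.rev) =
          (cs.simple a * cs.simple b) * (cs.simple a.rev * cs.simple b.rev) := by
        rw [mul_assoc, ← mul_assoc (cs.simple a.rev), ← c3.eq]
        simp only [mul_assoc]
      have c : Commute (cs.simple a * cs.simple b) (cs.simple a.rev * cs.simple b.rev) :=
        (caa.mul_right c1).mul_left (c3.mul_right c2)
      rw [e, c.mul_pow, pow_three_of_braid (by simp) (by simp) (braid_simple cs (by omega)),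
        pow_three_of_braid (by simp) (by simp) (braid_simple cs (by omega)).symm, one_mul]
    · have hM : (CoxeterMatrix.B ((n + 1) / 2)) i j = 4 := by
        simp only [CoxeterMatrix.B, Matrix.of_apply]
        rw [if_neg hne, if_pos (by omega)]
      rw [hM, gi]
      by_cases odd : Odd n
      · rw [hjodd last odd]
        have := Nat.odd_iff.mp odd
        exact pow_four_of_braid (by simp) (by simp) (by simp) caa (braid_simple cs (by omega))
          (braid_simple cs (by omega))
      · rw [hjeven last odd]
        have := Nat.not_odd_iff.mp odd
        have hbb := braid_simple cs (i := b) (j := b.rev) (by omega)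
        refine pow_four_of_braid (by simp) (by simp [mul_assoc]) (by simp) caa ?_ ?_
        · rw [hbb]
          exact braid_conj (by simp) (commute_simple cs (by omega)) (braid_simple cs (by omega))
        · exact (braid_conj (by simp) (commute_simple cs (by omega)).symm
            (braid_simple cs (by omega)).symm).symm
  · have hM : (CoxeterMatrix.B ((n + 1) / 2)) i j = 2 := by
      simp only [CoxeterMatrix.B, Matrix.of_apply]
      rw [if_neg hne, if_neg (by omega), if_neg (by omega)]
    rw [hM]
    refine pow_two_of_commute (sq i) (sq j) ?_
    have d1 : Commute (cs.simple a) (cs.simple b) := commute_simple cs (by omega)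
    have d2 : Commute (cs.simple a) (cs.simple b.rev) := commute_simple cs (by omega)
    have d3 : Commute (cs.simple a.rev) (cs.simple b) := (commute_simple cs (by omega)).symm
    have d4 : Commute (cs.simple a.rev) (cs.simple b.rev) := (commute_simple cs (by omega)).symm
    rw [gi]
    by_cases last : (j : ℕ) + 1 < (n + 1) / 2
    · rw [hjlt last]
      exact (d1.mul_right d2).mul_left (d3.mul_right d4)
    · by_cases odd : Odd n
      · rw [hjodd last odd]
        exact d1.mul_left d3
      · rw [hjeven last odd]
        exact ((d1.mul_right d2).mul_right d1).mul_left ((d3.mul_right d4).mul_right d3)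

/-- The folding homomorphism `φ : B_m → A_n`, `m = ⌊(n+1)/2⌋`: the unique homomorphism with
`φ (r_i) = foldingGenerator i`. -/
noncomputable def foldingHom {WA WB : Type*} [Group WA] [Group WB]
    (csA : CoxeterSystem (CoxeterMatrix.A n) WA)
    (csB : CoxeterSystem (CoxeterMatrix.B ((n + 1) / 2)) WB) : WB →* WA :=
  csB.lift ⟨foldingGenerator csA, isLiftable_foldingGenerator csA⟩

end Folding

/-! Both sides factor: the left one is B(-q) · F(q) and the right one A(-q) · B(q), where A, B are
the Poincaré polynomials and F is the generating function of `ℓ_A ∘ φ` on the group of type B. All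
are computed by one device. The subgroups generated by the simple reflections of index at least k
form a descending tower. Consecutive members are linked by explicit coset representatives: prefixes
of s_k ⋯ s_{n-1} in type A, and of r_k ⋯ r_{m-1} ⋯ r_k in type B, with indices from 0. A statistic
additive along the resulting normal form has a generating function that is a product over k
(`IsTower.finsum_pow`).

For Coxeter length, additivity (`IsTower.length_mul`) holds because normal-form length grows by at
most one under right multiplication by a generator. For `ℓ_A ∘ φ`, the length is squeezed between
word length and the number of inversions of a centrally symmetric permutation (`length_foldingHom`).
Each letter adds 2, except the last generator, which adds w = 1 (n odd) or w = 3 (n even). Every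
such weight is at least 1, so `ℓ_B ≤ ℓ_A ∘ φ`, which gives injectivity.

With [a]_x = 1 + x + ⋯ + x^(a-1), the identity then holds factor by factor (`poincare_identity`): 1
+ q^(2i+w) = (1+q)[2i+w]_{-q} because 2i+w is odd, and the factor 1+q completes the even powers to
[2i+2]_q. -/

namespace Folding

/-! ### Coset chains, towers of subgroups and normal forms -/

section Chain

variable {G : Type*} [Group G]

/-- `C 0, …, C (N - 1)` are representatives of the right cosets of `closure T'` in `closure T`,
numbered such that right multiplication by an involution `t ∈ T` either moves `C j` to some
`C j'` with `j' ≤ j + 1`, or amounts to left multiplication by some `t' ∈ T'`. -/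
structure IsChain (T T' : Set G) (N : ℕ) (C : ℕ → G) : Prop where
  pos : 0 < N
  zero : C 0 = 1
  subset : T' ⊆ T
  invol : ∀ t ∈ T, t * t = 1
  mem : ∀ j < N, C j ∈ Subgroup.closure T
  mul : ∀ j < N, ∀ t ∈ T,
    (∃ t' ∈ T', C j * t = t' * C j) ∨ ∃ j' < N, j' ≤ j + 1 ∧ C j * t = C j'
  inj : ∀ i < N, ∀ j < N, C i * (C j)⁻¹ ∈ Subgroup.closure T' → i = j

namespace IsChain

variable {T T' : Set G} {N : ℕ} {C : ℕ → G}

theorem closure_le (hc : IsChain T T' N C) : Subgroup.closure T' ≤ Subgroup.closure T :=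
  Subgroup.closure_mono hc.subset

/-- The products `h * C j` contain 1 and are stable under right multiplication by `T`; inverses add
nothing, as the generators are involutions. -/
theorem exists_eq_mul (hc : IsChain T T' N C) {x : G} (hx : x ∈ Subgroup.closure T) :
    ∃ h ∈ Subgroup.closure T', ∃ j < N, x = h * C j := by
  have key : ∀ x t, t ∈ T → (∃ h ∈ Subgroup.closure T', ∃ j < N, x = h * C j) →
      ∃ h ∈ Subgroup.closure T', ∃ j < N, x * t = h * C j := by
    rintro x t ht ⟨h, hh, j, hj, rfl⟩
    rcases hc.mul j hj t ht with ⟨t', ht', e⟩ | ⟨j', hj', -, e⟩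
    · exact ⟨h * t', mul_mem hh (Subgroup.subset_closure ht'), j, hj, by
        rw [mul_assoc, e, mul_assoc]⟩
    · exact ⟨h, hh, j', hj', by rw [mul_assoc, e]⟩
  induction hx using Subgroup.closure_induction_right with
  | one => exact ⟨1, one_mem _, 0, hc.pos, by rw [hc.zero, one_mul]⟩
  | mul_right x hx t ht ih => exact key x t ht ih
  | mul_inv_cancel x hx t ht ih =>
    rw [inv_eq_of_mul_eq_one_left (hc.invol t ht)]
    exact key x t ht ih

theorem eq_of_mul_eq (hc : IsChain T T' N C) {h h' : G} (hh : h ∈ Subgroup.closure T')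
    (hh' : h' ∈ Subgroup.closure T') {i j : ℕ} (hi : i < N) (hj : j < N)
    (e : h * C i = h' * C j) : h = h' ∧ i = j := by
  have hij : i = j := by
    refine hc.inj i hi j hj ?_
    have : C i * (C j)⁻¹ = h⁻¹ * h' := by
      rw [mul_inv_eq_iff_eq_mul, mul_assoc, ← e, inv_mul_cancel_left]
    rw [this]
    exact mul_mem (inv_mem hh) hh'
  subst hij
  exact ⟨mul_right_cancel e, rfl⟩

theorem bijOn (hc : IsChain T T' N C) :
    Set.BijOn (fun p : G × ℕ => p.1 * C p.2)
      ((Subgroup.closure T' : Set G) ×ˢ (Finset.range N : Set ℕ)) (Subgroup.closure T) := by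
  refine ⟨?_, ?_, ?_⟩
  · rintro ⟨h, j⟩ ⟨hh, hj⟩
    exact mul_mem (hc.closure_le hh) (hc.mem j (by simpa using hj))
  · rintro ⟨h, i⟩ ⟨hh, hi⟩ ⟨h', j⟩ ⟨hh', hj⟩ e
    obtain ⟨e1, e2⟩ := hc.eq_of_mul_eq hh hh' (by simpa using hi) (by simpa using hj) e
    exact Prod.ext e1 e2
  · intro x hx
    obtain ⟨h, hh, j, hj, rfl⟩ := hc.exists_eq_mul hx
    exact ⟨(h, j), ⟨hh, by simpa using hj⟩, rfl⟩

theorem finite (hc : IsChain T T' N C) (hf : (Subgroup.closure T' : Set G).Finite) :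
    (Subgroup.closure T : Set G).Finite := by
  rw [← hc.bijOn.image_eq]
  exact (hf.prod (Finset.finite_toSet _)).image _

theorem finsum_mem {R : Type*} [CommSemiring R] (hc : IsChain T T' N C)
    (hf : (Subgroup.closure T' : Set G).Finite) (F : G → R) (g : ℕ → R)
    (hF : ∀ h ∈ Subgroup.closure T', ∀ j < N, F (h * C j) = F h * g j) :
    ∑ᶠ x ∈ (Subgroup.closure T : Set G), F x =
      (∑ᶠ x ∈ (Subgroup.closure T' : Set G), F x) * ∑ j ∈ Finset.range N, g j := by
  rw [← finsum_mem_eq_of_bijOn _ hc.bijOn (f := fun p : G × ℕ => F p.1 * g p.2)]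
  · lift (Subgroup.closure T' : Set G) to Finset G using hf with S
    rw [← Finset.coe_product, finsum_mem_coe_finset, finsum_mem_coe_finset,
      Finset.sum_product, Finset.sum_mul_sum]
  · rintro ⟨h, j⟩ ⟨hh, hj⟩
    exact (hF h hh j (by simpa using hj)).symm

/-- A function on `closure T'` that grows by at most one under right multiplication by `T'`
extends to such a function on `closure T`, with value `j` on `C j`. -/
theorem exists_extension (hc : IsChain T T' N C) (f : G → ℕ)
    (hf : ∀ h ∈ Subgroup.closure T', ∀ t ∈ T', f (h * t) ≤ f h + 1) :
    ∃ F : G → ℕ, (∀ h ∈ Subgroup.closure T', ∀ j < N, F (h * C j) = f h + j) ∧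
      ∀ x ∈ Subgroup.closure T, ∀ t ∈ T, F (x * t) ≤ F x + 1 := by
  classical
  choose! a ha b hb hab using fun (x : G) (hx : x ∈ Subgroup.closure T) => hc.exists_eq_mul hx
  have key : ∀ h ∈ Subgroup.closure T', ∀ j < N, f (a (h * C j)) + b (h * C j) = f h + j := by
    intro h hh j hj
    have hx : h * C j ∈ Subgroup.closure T := mul_mem (hc.closure_le hh) (hc.mem j hj)
    obtain ⟨e1, e2⟩ := hc.eq_of_mul_eq hh (ha _ hx) hj (hb _ hx) (hab _ hx)
    rw [← e1, ← e2]
  refine ⟨fun x => f (a x) + b x, key, ?_⟩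
  intro x hx t ht
  obtain ⟨h, hh, j, hj, rfl⟩ := hc.exists_eq_mul hx
  dsimp only
  rw [key h hh j hj]
  rcases hc.mul j hj t ht with ⟨t', ht', e⟩ | ⟨j', hj', hle, e⟩
  · rw [mul_assoc, e, ← mul_assoc, key _ (mul_mem hh (Subgroup.subset_closure ht')) j hj]
    have := hf h hh t' ht'
    omega
  · rw [mul_assoc, e, key h hh j' hj']
    omega

end IsChain

/-- A descending sequence of subgroups `closure (T k)`, from the whole group to the trivial group,
any two consecutive ones being linked by a chain of coset representatives. -/
structure IsTower (K : ℕ) (T : ℕ → Set G) (N : ℕ → ℕ) (C : ℕ → ℕ → G) : Prop where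
  top : Subgroup.closure (T 0) = ⊤
  bot : Subgroup.closure (T K) = ⊥
  chain : ∀ k < K, IsChain (T k) (T (k + 1)) (N k) (C k)

namespace IsTower

variable {K : ℕ} {T : ℕ → Set G} {N : ℕ → ℕ} {C : ℕ → ℕ → G}

theorem finite_closure (ht : IsTower K T N C) {k : ℕ} (hk : k ≤ K) :
    (Subgroup.closure (T k) : Set G).Finite := by
  induction hk using Nat.decreasingInduction with
  | self => rw [ht.bot]; simp
  | of_succ k hk ih => exact (ht.chain k hk).finite ih

theorem finite (ht : IsTower K T N C) : Finite G := by
  have := ht.finite_closure (Nat.zero_le K)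
  rw [ht.top] at this
  exact Set.finite_univ_iff.mp (by simpa using this)

theorem closure_le (ht : IsTower K T N C) {k l : ℕ} (hkl : k ≤ l) (hl : l ≤ K) :
    Subgroup.closure (T l) ≤ Subgroup.closure (T k) := by
  induction l, hkl using Nat.le_induction with
  | base => exact le_rfl
  | succ l hkl ih => exact ((ht.chain l (by omega)).closure_le).trans (ih (by omega))

theorem finsum_pow {R : Type*} [CommSemiring R] (ht : IsTower K T N C) (L : G → ℕ) (hL : L 1 = 0)
    (wt : ℕ → ℕ → ℕ)
    (hwt : ∀ k < K, ∀ h ∈ Subgroup.closure (T (k + 1)), ∀ j < N k,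
      L (h * C k j) = L h + wt k j) (x : R) :
    ∑ᶠ w : G, x ^ L w = ∏ k ∈ Finset.range K, ∑ j ∈ Finset.range (N k), x ^ wt k j := by
  have key : ∀ k ≤ K, ∑ᶠ w ∈ (Subgroup.closure (T k) : Set G), x ^ L w =
      ∏ i ∈ Finset.Ico k K, ∑ j ∈ Finset.range (N i), x ^ wt i j := by
    intro k hk
    induction hk using Nat.decreasingInduction with
    | self => rw [ht.bot]; simp [hL]
    | of_succ k hk ih =>
      rw [(ht.chain k hk).finsum_mem (ht.finite_closure hk) _ (fun j => x ^ wt k j), ih,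
        Finset.prod_eq_prod_Ico_succ_bot hk, mul_comm]
      intro h hh j hj
      rw [hwt k hk h hh j hj, pow_add]
  have := key 0 (Nat.zero_le _)
  rw [ht.top, Nat.Ico_zero_eq_range] at this
  simpa using this

/-- Induction along the normal form: `f` gains at most `wt`, `g` at least `wt`. All length
comparisons below reduce to this. -/
theorem le_of_chain (ht : IsTower K T N C) {f g : G → ℕ} (h1 : f 1 ≤ g 1)
    (wt : ℕ → ℕ → ℕ)
    (hf : ∀ k < K, ∀ h ∈ Subgroup.closure (T (k + 1)), ∀ j < N k,
      f (h * C k j) ≤ f h + wt k j)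
    (hg : ∀ k < K, ∀ h ∈ Subgroup.closure (T (k + 1)), ∀ j < N k,
      g h + wt k j ≤ g (h * C k j)) (x : G) : f x ≤ g x := by
  have key : ∀ k ≤ K, ∀ x ∈ Subgroup.closure (T k), f x ≤ g x := by
    intro k hk
    induction hk using Nat.decreasingInduction with
    | self =>
      rw [ht.bot]
      intro x hx
      rwa [Subgroup.mem_bot.mp hx]
    | of_succ k hk ih =>
      intro x hx
      obtain ⟨h, hh, j, hj, rfl⟩ := (ht.chain k hk).exists_eq_mul hx
      have := hf k hk h hh j hj
      have := hg k hk h hh j hj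
      have := ih h hh
      omega
  exact key 0 (Nat.zero_le _) x (by rw [ht.top]; trivial)

/-- `F` is the length of the normal form. Its growth bound climbs the tower by `exists_extension`: a
generator either shifts `j` up by at most one or acts as a generator of the smaller subgroup on `h`.
-/
theorem exists_normal_length (ht : IsTower K T N C) {k : ℕ} (hk : k ≤ K) :
    ∃ F : G → ℕ, F 1 = 0 ∧ (∀ x ∈ Subgroup.closure (T k), ∀ t ∈ T k, F (x * t) ≤ F x + 1) ∧
      ∀ l, k ≤ l → l < K → ∀ h ∈ Subgroup.closure (T (l + 1)), ∀ j < N l,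
        F (h * C l j) = F h + j := by
  induction hk using Nat.decreasingInduction with
  | self =>
    refine ⟨fun _ => 0, rfl, fun _ _ _ _ => by simp, fun l h1 h2 => by omega⟩
  | of_succ k hk ih =>
    obtain ⟨f, f1, hf, hadd⟩ := ih
    have hc := ht.chain k hk
    obtain ⟨F, hF, hlip⟩ := hc.exists_extension f hf
    have hFf : ∀ h ∈ Subgroup.closure (T (k + 1)), F h = f h := by
      intro h hh
      simpa [hc.zero] using hF h hh 0 hc.pos
    refine ⟨F, by rw [hFf 1 (one_mem _), f1], hlip, ?_⟩
    intro l hkl hl h hh j hj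
    rcases hkl.eq_or_lt with rfl | hlt
    · rw [hF h hh j hj, hFf h hh]
    · have h1 : h ∈ Subgroup.closure (T l) := (ht.chain l hl).closure_le hh
      have h2 : h * C l j ∈ Subgroup.closure (T l) := mul_mem h1 ((ht.chain l hl).mem j hj)
      have hle := ht.closure_le (Nat.succ_le_of_lt hlt) hl.le
      rw [hFf _ (hle h1), hFf _ (hle h2), hadd l hlt hl h hh j hj]

/-- In a Coxeter group with a tower of chains on the simple reflections, the normal form of an
element is a reduced word. -/
theorem length_mul {B : Type*} {M : CoxeterMatrix B} (cs : CoxeterSystem M G)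
    (ht : IsTower K T N C) (hT : Set.range cs.simple ⊆ T 0)
    (hC : ∀ k < K, ∀ j < N k, cs.length (C k j) ≤ j) :
    ∀ k < K, ∀ h ∈ Subgroup.closure (T (k + 1)), ∀ j < N k,
      cs.length (h * C k j) = cs.length h + j := by
  obtain ⟨F, F1, hlip, hadd⟩ := ht.exists_normal_length (Nat.zero_le K)
  have h1 : ∀ x, cs.length x ≤ F x := by
    refine ht.le_of_chain (by simp) (fun _ j => j) ?_ ?_
    · intro k hk h _ j hj
      exact (cs.length_mul_le _ _).trans (Nat.add_le_add_left (hC k hk j hj) _)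
    · intro k hk h hh j hj
      exact (hadd k (Nat.zero_le _) hk h hh j hj).ge
  -- Read a reduced word letter by letter; each letter raises `F` by at most one.
  have h2 : ∀ x, F x ≤ cs.length x := by
    intro x
    obtain ⟨ω, hω, rfl⟩ := cs.exists_isReduced x
    rw [hω.eq]
    clear hω
    induction ω using List.reverseRecOn with
    | nil => simp [F1]
    | append_singleton ω i ih =>
      rw [cs.wordProd_append, cs.wordProd_singleton, List.length_append, List.length_singleton]
      have := hlip (cs.wordProd ω) (by rw [ht.top]; trivial) _ (hT ⟨i, rfl⟩)
      omega
  intro k hk h hh j hj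
  rw [le_antisymm (h1 (h * C k j)) (h2 _), le_antisymm (h1 h) (h2 h),
    hadd k (Nat.zero_le _) hk h hh j hj]

end IsTower

/-- The product `b k * b (k + 1) * ⋯ * b (k + j - 1)`. -/
def chainProd (b : ℕ → G) (k : ℕ) : ℕ → G
  | 0 => 1
  | j + 1 => chainProd b k j * b (k + j)

theorem chainProd_mem (b : ℕ → G) (k j : ℕ) (H : Subgroup G) (h : ∀ i < j, b (k + i) ∈ H) :
    chainProd b k j ∈ H := by
  induction j with
  | zero => exact one_mem _
  | succ j ih => exact mul_mem (ih fun i hi => h i (by omega)) (h j (by omega))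

theorem length_chainProd_le {B : Type*} {M : CoxeterMatrix B} (cs : CoxeterSystem M G)
    (b : ℕ → G) (hb : ∀ i, cs.length (b i) ≤ 1) (k j : ℕ) :
    cs.length (chainProd b k j) ≤ j := by
  induction j with
  | zero => simp [chainProd]
  | succ j ih =>
    exact (cs.length_mul_le _ _).trans (Nat.add_le_add ih (hb _))

end Chain

/-! ### Multiplication tables of the coset representatives -/

section Tables

variable {G : Type*} [Group G]

/-- Since `T'` fixes `k`, the preimage of `k` under an element depends only on its right coset; for
`C j` it is `p j`. -/
theorem IsChain.inj_of_action {T' : Set G} {N k : ℕ} {C : ℕ → G} (ρ : G →* Equiv.Perm ℕ)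
    (p : ℕ → ℕ) (hfix : ∀ t ∈ T', ρ t k = k) (hp : ∀ j < N, ρ (C j) (p j) = k)
    (hinj : Function.Injective p) :
    ∀ i < N, ∀ j < N, C i * (C j)⁻¹ ∈ Subgroup.closure T' → i = j := by
  intro i hi j hj hmem
  have hle : Subgroup.closure T' ≤ (MulAction.stabilizer (Equiv.Perm ℕ) k).comap ρ := by
    rw [Subgroup.closure_le]
    intro t ht
    exact hfix t ht
  have h : ρ (C i * (C j)⁻¹) k = k := hle hmem
  apply hinj
  apply (ρ (C i)).injective
  rw [hp i hi]
  conv_lhs => rw [← h, ← hp j hj]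
  rw [← Equiv.Perm.mul_apply, ← map_mul, inv_mul_cancel_right]

/-- Multiplication of the coset representatives `s k ⋯ s (k + j - 1)` in type `A`. -/
theorem chainProd_mul_typeA {n : ℕ} {s : ℕ → G}
    (hcomm : ∀ i j, i + 1 < j → Commute (s i) (s j))
    (hbraid : ∀ i, i + 1 < n → s i * s (i + 1) * s i = s (i + 1) * s i * s (i + 1)) (k : ℕ) :
    ∀ j, k + j ≤ n → ∀ i, k ≤ i → i < n → i ≠ k + j → i + 1 ≠ k + j →
      ∃ i', k < i' ∧ i' < n ∧ chainProd s k j * s i = s i' * chainProd s k j := by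
  intro j
  induction j using Nat.strong_induction_on with
  | _ j ih =>
  intro hj i hki hin h1 h2
  match j with
  | 0 => exact ⟨i, by omega, hin, by simp [chainProd]⟩
  | j + 1 =>
    -- Here the word ends in `s i * s (i + 1)`. Appending `s i` and braiding produces an `s (i + 1)`
    -- that moves left through the prefix ending before `s i`, two letters shorter. Otherwise `s i`
    -- commutes with the last letter.
    by_cases h3 : i + 1 = k + j
    · match j with
      | 0 => omega
      | j + 1 =>
        obtain rfl : i = k + j := by omega
        obtain ⟨i', a1, a2, a3⟩ := ih j (by omega) (by omega) (k + j + 1) (by omega) (by omega)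
          (by omega) (by omega)
        refine ⟨i', a1, a2, ?_⟩
        simp only [chainProd, ← add_assoc]
        rw [mul_assoc, mul_assoc, ← mul_assoc (s (k + j)), hbraid _ (by omega), mul_assoc,
          ← mul_assoc, a3]
        simp only [mul_assoc]
    · have hc : Commute (s (k + j)) (s i) := by
        rcases lt_or_gt_of_ne (show i ≠ k + j by omega) with h | h
        · exact (hcomm _ _ (by omega)).symm
        · exact hcomm _ _ (by omega)
      obtain ⟨i', a1, a2, a3⟩ := ih j (by omega) (by omega) i hki hin (by omega) h3
      refine ⟨i', a1, a2, ?_⟩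
      simp only [chainProd]
      rw [mul_assoc, hc.eq, ← mul_assoc, a3, mul_assoc]

/-- The `e`-th index in the sequence `0, 1, …, m - 1, m - 2, …, 0`. -/
def zigzag (m e : ℕ) : ℕ := if e < m then e else 2 * m - 2 - e

theorem zigzag_of_lt {m e : ℕ} (h : e < m) : zigzag m e = e := if_pos h

theorem zigzag_of_le {m e : ℕ} (h : m ≤ e) : zigzag m e = 2 * m - 2 - e := if_neg (by omega)

/-- Multiplication of the coset representatives
`r k ⋯ r (m - 2) * r (m - 1) * r (m - 2) ⋯` in type `B`. -/
theorem chainProd_mul_typeB {m : ℕ} {r : ℕ → G}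
    (hcomm : ∀ i j, i + 1 < j → Commute (r i) (r j))
    (hbraid : ∀ i, i + 2 < m → r i * r (i + 1) * r i = r (i + 1) * r i * r (i + 1))
    (hfour : ∀ i, i + 2 = m →
      r i * r (i + 1) * r i * r (i + 1) = r (i + 1) * r i * r (i + 1) * r i)
    (k : ℕ) (hk : k < m) :
    ∀ j, j < 2 * (m - k) → ∀ i, k ≤ i → i < m → i ≠ k + j → i + 1 ≠ k + j →
      i + (k + j) + 2 ≠ 2 * m → i + (k + j) + 1 ≠ 2 * m →
      ∃ i', k < i' ∧ i' < m ∧ chainProd (fun e => r (zigzag m e)) k j * r i =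
        r i' * chainProd (fun e => r (zigzag m e)) k j := by
  intro j
  induction j using Nat.strong_induction_on with
  | _ j ih =>
  intro hj i hki him h1 h2 h3 h4
  match j with
  | 0 => exact ⟨i, by omega, him, by simp [chainProd]⟩
  | j + 1 =>
    by_cases h5 : k + j < m
    · by_cases h6 : i + 1 = k + j
      · match j with
        | 0 => omega
        | j + 1 =>
          obtain rfl : i = k + j := by omega
          obtain ⟨i', a1, a2, a3⟩ := ih j (by omega) (by omega) (k + j + 1) (by omega) (by omega)
            (by omega) (by omega) (by omega) (by omega)
          refine ⟨i', a1, a2, ?_⟩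
          simp only [chainProd, ← add_assoc]
          rw [zigzag_of_lt (show k + j < m by omega), zigzag_of_lt (show k + j + 1 < m by omega),
            mul_assoc, mul_assoc, ← mul_assoc (r (k + j)), hbraid _ (by omega), mul_assoc,
            ← mul_assoc, a3]
          simp only [mul_assoc]
      · have hc : Commute (r (k + j)) (r i) := by
          rcases lt_or_gt_of_ne (show i ≠ k + j by omega) with h | h
          · exact (hcomm _ _ (by omega)).symm
          · exact hcomm _ _ (by omega)
        obtain ⟨i', a1, a2, a3⟩ := ih j (by omega) (by omega) i hki him (by omega) h6
          (by omega) (by omega)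
        refine ⟨i', a1, a2, ?_⟩
        simp only [chainProd]
        rw [zigzag_of_lt h5, mul_assoc, hc.eq, ← mul_assoc, a3, mul_assoc]
    -- Descending half, last letter `r q`. The hypotheses exclude `i = q` and `i + 1 = q`, so only
    -- `i = q + 1` fails to commute with it.
    · obtain ⟨q, hq⟩ : ∃ q, q + (k + j) + 2 = 2 * m := ⟨2 * m - 2 - (k + j), by omega⟩
      have hz : zigzag m (k + j) = q := by rw [zigzag_of_le (by omega)]; omega
      by_cases h6 : i = q + 1
      · subst h6
        -- Just past the turning point the word ends in `r (m - 2) * r (m - 1) * r (m - 2)` and `i =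
        -- m - 1`, which calls for the relation of order four. Further on it ends in `r (q + 1) * r
        -- q`, and the ordinary braid relation suffices.
        by_cases h7 : k + j = m
        · match j with
          | 0 => omega
          | 1 => omega
          | j + 2 =>
            obtain rfl : q = k + j := by omega
            obtain ⟨i', a1, a2, a3⟩ := ih j (by omega) (by omega) (k + j + 1) (by omega)
              (by omega) (by omega) (by omega) (by omega) (by omega)
            refine ⟨i', a1, a2, ?_⟩
            simp only [← add_assoc] at hz
            simp only [chainProd, ← add_assoc]
            rw [hz, zigzag_of_lt (show k + j < m by omega),
              zigzag_of_lt (show k + j + 1 < m by omega)]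
            calc _ = chainProd (fun e => r (zigzag m e)) k j *
                  (r (k + j) * r (k + j + 1) * r (k + j) * r (k + j + 1)) := by
                  simp only [mul_assoc]
              _ = (chainProd (fun e => r (zigzag m e)) k j * r (k + j + 1)) *
                  (r (k + j) * r (k + j + 1) * r (k + j)) := by
                  rw [hfour _ (by omega)]; simp only [mul_assoc]
              _ = _ := by rw [a3]; simp only [mul_assoc]
        · match j with
          | 0 => omega
          | j + 1 =>
            have hz' : zigzag m (k + j) = q + 1 := by rw [zigzag_of_le (by omega)]; omega
            obtain ⟨i', a1, a2, a3⟩ := ih j (by omega) (by omega) q (by omega) (by omega)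
              (by omega) (by omega) (by omega) (by omega)
            refine ⟨i', a1, a2, ?_⟩
            simp only [chainProd]
            rw [hz, hz']
            calc _ = chainProd (fun e => r (zigzag m e)) k j *
                  (r (q + 1) * r q * r (q + 1)) := by simp only [mul_assoc]
              _ = (chainProd (fun e => r (zigzag m e)) k j * r q) * (r (q + 1) * r q) := by
                  rw [← hbraid _ (by omega)]; simp only [mul_assoc]
              _ = _ := by rw [a3]; simp only [mul_assoc]
      · have hc : Commute (r q) (r i) := by
          rcases lt_or_gt_of_ne (show i ≠ q by omega) with h | h
          · exact (hcomm _ _ (by omega)).symm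
          · exact hcomm _ _ (by omega)
        obtain ⟨i', a1, a2, a3⟩ := ih j (by omega) (by omega) i hki him (by omega) (by omega)
          (by omega) (by omega)
        refine ⟨i', a1, a2, ?_⟩
        simp only [chainProd]
        rw [hz, mul_assoc, hc.eq, ← mul_assoc, a3, mul_assoc]

theorem isChain_typeA {n : ℕ} {s : ℕ → G} (hsq : ∀ i, s i * s i = 1)
    (hcomm : ∀ i j, i + 1 < j → Commute (s i) (s j))
    (hbraid : ∀ i, i + 1 < n → s i * s (i + 1) * s i = s (i + 1) * s i * s (i + 1))
    (ρ : G →* Equiv.Perm ℕ) (hρ : ∀ i < n, ρ (s i) = Equiv.swap i (i + 1))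
    {k : ℕ} (hk : k < n) :
    IsChain (s '' Set.Ico k n) (s '' Set.Ico (k + 1) n) (n - k + 1) (chainProd s k) where
  pos := by omega
  zero := rfl
  subset := Set.image_mono (Set.Ico_subset_Ico_left (by omega))
  invol := by rintro _ ⟨i, -, rfl⟩; exact hsq i
  mem j hj := chainProd_mem _ _ _ _ fun i hi =>
    Subgroup.subset_closure ⟨k + i, ⟨by omega, by omega⟩, rfl⟩
  mul := by
    rintro j hj _ ⟨i, ⟨hki, hin⟩, rfl⟩
    by_cases h1 : i = k + j
    · right
      exact ⟨j + 1, by omega, le_rfl, by rw [h1]; rfl⟩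
    by_cases h2 : i + 1 = k + j
    · right
      match j with
      | 0 => omega
      | j + 1 =>
        refine ⟨j, by omega, by omega, ?_⟩
        obtain rfl : i = k + j := by omega
        simp only [chainProd]
        rw [mul_assoc, hsq, mul_one]
    · left
      obtain ⟨i', a1, a2, a3⟩ := chainProd_mul_typeA hcomm hbraid k j (by omega) i hki hin h1 h2
      exact ⟨_, ⟨i', ⟨a1, a2⟩, rfl⟩, a3⟩
  inj := by
    refine IsChain.inj_of_action (k := k) ρ (fun j => k + j) ?_ ?_ (add_right_injective k)
    · rintro _ ⟨i, ⟨h1, h2⟩, rfl⟩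
      rw [hρ i h2, Equiv.swap_apply_of_ne_of_ne] <;> omega
    · intro j
      induction j with
      | zero => simp [chainProd]
      | succ j ih =>
        intro hj
        simp only [chainProd, map_mul, Equiv.Perm.mul_apply]
        rw [hρ _ (by omega), ← add_assoc, Equiv.swap_apply_right]
        exact ih (by omega)

/-- The action `ρ` only separates cosets: the letter at position `e` carries `p (e + 1)` back to `p
e`, so the j-th representative carries `p (k + j)` to `k`. -/
theorem isChain_typeB {m : ℕ} {r : ℕ → G} (hsq : ∀ i, r i * r i = 1)
    (hcomm : ∀ i j, i + 1 < j → Commute (r i) (r j))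
    (hbraid : ∀ i, i + 2 < m → r i * r (i + 1) * r i = r (i + 1) * r i * r (i + 1))
    (hfour : ∀ i, i + 2 = m →
      r i * r (i + 1) * r i * r (i + 1) = r (i + 1) * r i * r (i + 1) * r i)
    (ρ : G →* Equiv.Perm ℕ) (p : ℕ → ℕ) (hp : StrictMono p) (hpk : ∀ k < m, p k = k)
    (hfix : ∀ i < m, ∀ k < i, ρ (r i) k = k)
    (hstep : ∀ e, e + 1 < 2 * m → ρ (r (zigzag m e)) (p (e + 1)) = p e)
    {k : ℕ} (hk : k < m) :
    IsChain (r '' Set.Ico k m) (r '' Set.Ico (k + 1) m) (2 * (m - k))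
      (chainProd (fun e => r (zigzag m e)) k) where
  pos := by omega
  zero := rfl
  subset := Set.image_mono (Set.Ico_subset_Ico_left (by omega))
  invol := by rintro _ ⟨i, -, rfl⟩; exact hsq i
  mem j hj := chainProd_mem _ _ _ _ fun i hi =>
    Subgroup.subset_closure ⟨zigzag m (k + i), by
      unfold zigzag; split_ifs <;> constructor <;> omega, rfl⟩
  mul := by
    rintro j hj _ ⟨i, ⟨hki, him⟩, rfl⟩
    by_cases h1 : i = k + j
    · right
      exact ⟨j + 1, by omega, le_rfl, by simp only [chainProd]; rw [zigzag_of_lt (by omega), h1]⟩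
    by_cases h3 : i + (k + j) + 2 = 2 * m
    · right
      refine ⟨j + 1, by omega, le_rfl, ?_⟩
      simp only [chainProd]
      rw [zigzag_of_le (by omega), show 2 * m - 2 - (k + j) = i by omega]
    -- A generator equal to the last letter cancels it.
    have hback : ∀ l, j = l + 1 → zigzag m (k + l) = i →
        ∃ j' < 2 * (m - k), j' ≤ j + 1 ∧ chainProd (fun e => r (zigzag m e)) k j * r i =
          chainProd (fun e => r (zigzag m e)) k j' := by
      rintro l rfl hz
      refine ⟨l, by omega, by omega, ?_⟩
      simp only [chainProd]
      rw [hz, mul_assoc, hsq, mul_one]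
    by_cases h2 : i + 1 = k + j
    · right
      exact hback (j - 1) (by omega) (by rw [zigzag_of_lt (by omega)]; omega)
    by_cases h4 : i + (k + j) + 1 = 2 * m
    · right
      refine hback (j - 1) (by omega) ?_
      unfold zigzag
      split_ifs <;> omega
    · left
      obtain ⟨i', a1, a2, a3⟩ :=
        chainProd_mul_typeB hcomm hbraid hfour k hk j hj i hki him h1 h2 h3 h4
      exact ⟨_, ⟨i', ⟨a1, a2⟩, rfl⟩, a3⟩
  inj := by
    refine IsChain.inj_of_action (k := k) ρ (fun j => p (k + j)) ?_ ?_
      (hp.injective.comp (add_right_injective k))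
    · rintro _ ⟨i, ⟨h1, h2⟩, rfl⟩
      exact hfix i h2 k h1
    · intro j
      induction j with
      | zero => intro _; simp [chainProd, hpk k hk]
      | succ j ih =>
        intro hj
        simp only [chainProd, map_mul, Equiv.Perm.mul_apply]
        rw [← add_assoc, hstep _ (by omega)]
        exact ih (by omega)

end Tables

/-- The simple generators of a Coxeter system indexed by `Fin n`, continued by `1`. -/
noncomputable def gen {n : ℕ} {M : CoxeterMatrix (Fin n)} {W : Type*} [Group W]
    (cs : CoxeterSystem M W) (i : ℕ) : W :=
  if h : i < n then cs.simple ⟨i, h⟩ else 1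

/-! ### Generators indexed by natural numbers -/

section Gen

variable {n : ℕ} {M : CoxeterMatrix (Fin n)} {W : Type*} [Group W] (cs : CoxeterSystem M W)

theorem gen_of_lt {i : ℕ} (h : i < n) : gen cs i = cs.simple ⟨i, h⟩ := dif_pos h

theorem gen_of_le {i : ℕ} (h : n ≤ i) : gen cs i = 1 := dif_neg (by omega)

theorem gen_mul_self (i : ℕ) : gen cs i * gen cs i = 1 := by
  unfold gen; split_ifs <;> simp

theorem length_gen_le (i : ℕ) : cs.length (gen cs i) ≤ 1 := by
  unfold gen; split_ifs <;> simp

theorem range_simple_eq_image_gen : Set.range cs.simple = gen cs '' Set.Ico 0 n := by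
  ext x
  constructor
  · rintro ⟨i, rfl⟩
    exact ⟨i, ⟨by omega, i.2⟩, gen_of_lt cs i.2⟩
  · rintro ⟨i, ⟨-, h⟩, rfl⟩
    exact ⟨⟨i, h⟩, (gen_of_lt cs h).symm⟩

theorem closure_image_gen_zero : Subgroup.closure (gen cs '' Set.Ico 0 n) = ⊤ := by
  rw [← range_simple_eq_image_gen, cs.subgroup_closure_range_simple]

theorem closure_image_gen_self : Subgroup.closure (gen cs '' Set.Ico n n) = ⊥ := by
  simp

end Gen

/-! ### Type A: Poincaré polynomial and inversions -/

section TypeA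

variable {n : ℕ} {W : Type*} [Group W] (cs : CoxeterSystem (CoxeterMatrix.A n) W)

theorem commute_gen_typeA (i j : ℕ) (h : i + 1 < j) : Commute (gen cs i) (gen cs j) := by
  rcases lt_or_ge j n with hj | hj
  · rw [gen_of_lt cs hj, gen_of_lt cs (show i < n by omega)]
    exact commute_simple cs h
  · rw [gen_of_le cs hj]; exact Commute.one_right _

theorem braid_gen_typeA (i : ℕ) (h : i + 1 < n) :
    gen cs i * gen cs (i + 1) * gen cs i = gen cs (i + 1) * gen cs i * gen cs (i + 1) := by
  rw [gen_of_lt cs h, gen_of_lt cs (show i < n by omega)]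
  exact braid_simple cs rfl

theorem isLiftable_swap (n : ℕ) :
    (CoxeterMatrix.A n).IsLiftable fun i : Fin n => Equiv.swap (i : ℕ) (i + 1) := by
  suffices H : ∀ i j : Fin n, (i : ℕ) < j →
      (Equiv.swap (i : ℕ) (i + 1) * Equiv.swap (j : ℕ) (j + 1)) ^ (CoxeterMatrix.A n) i j = 1 by
    intro i j
    rcases lt_trichotomy (i : ℕ) j with h | h | h
    · exact H i j h
    · obtain rfl := Fin.ext h
      simp
    · rw [(CoxeterMatrix.A n).symmetric i j]
      exact pow_swap (H j i h)
  intro i j hij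
  have hne : i ≠ j := by rintro rfl; omega
  by_cases adj : (i : ℕ) + 1 = j
  · have hM : (CoxeterMatrix.A n) i j = 3 := by
      simp only [CoxeterMatrix.A, Matrix.of_apply]
      rw [if_neg hne, if_pos (by omega)]
    rw [hM, ← adj]
    refine pow_three_of_braid (by simp) (by simp) (Equiv.ext fun x => ?_)
    simp only [Equiv.Perm.mul_apply, Equiv.swap_apply_def]
    grind
  · have hM : (CoxeterMatrix.A n) i j = 2 := by
      simp only [CoxeterMatrix.A, Matrix.of_apply]
      rw [if_neg hne, if_neg (by omega)]
    rw [hM]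
    refine pow_two_of_commute (by simp) (by simp) (Equiv.ext fun x => ?_)
    simp only [Equiv.Perm.mul_apply, Equiv.swap_apply_def]
    grind

/-- The action of a Coxeter group of type `A_n` on `{0, …, n} ⊆ ℕ` by permutations. -/
noncomputable def permHom : W →* Equiv.Perm ℕ :=
  cs.lift ⟨fun i : Fin n => Equiv.swap (i : ℕ) (i + 1), isLiftable_swap n⟩

theorem permHom_gen {i : ℕ} (h : i < n) : permHom cs (gen cs i) = Equiv.swap i (i + 1) := by
  rw [gen_of_lt cs h]
  exact cs.lift_apply_simple (isLiftable_swap n) ⟨i, h⟩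

theorem isTower_typeA :
    IsTower n (fun k => gen cs '' Set.Ico k n) (fun k => n - k + 1) (chainProd (gen cs)) where
  top := closure_image_gen_zero cs
  bot := closure_image_gen_self cs
  chain _ hk := isChain_typeA (gen_mul_self cs) (commute_gen_typeA cs) (braid_gen_typeA cs)
    (permHom cs) (fun _ h => permHom_gen cs h) hk

theorem finsum_pow_length_typeA {R : Type*} [CommSemiring R] (x : R) :
    ∑ᶠ w : W, x ^ cs.length w =
      ∏ i ∈ Finset.range n, ∑ j ∈ Finset.range (i + 2), x ^ j := by
  have ht := isTower_typeA cs
  rw [ht.finsum_pow cs.length cs.length_one (fun _ j => j)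
    (ht.length_mul cs (range_simple_eq_image_gen cs).subset
      fun k _ j _ => length_chainProd_le cs _ (length_gen_le cs) k j),
    ← Finset.prod_range_reflect]
  refine Finset.prod_congr rfl fun i hi => ?_
  rw [Finset.mem_range] at hi
  rw [show n - (n - 1 - i) + 1 = i + 2 by omega]

/-- The number of inversions of a permutation among the points `0, …, n`. -/
def invNum (n : ℕ) (σ : Equiv.Perm ℕ) : ℕ :=
  ((Finset.range (n + 1) ×ˢ Finset.range (n + 1)).filter
    fun p => p.1 < p.2 ∧ σ p.2 < σ p.1).card

/-- The swap preserves the order of every pair except {i, i+1}. So it carries the inversions of `σ`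
bijectively to those of the product other than the new one, `(i, i + 1)`. -/
theorem invNum_mul_swap {n : ℕ} (σ : Equiv.Perm ℕ) {i : ℕ} (hi : i < n)
    (h : σ i < σ (i + 1)) : invNum n (σ * Equiv.swap i (i + 1)) = invNum n σ + 1 := by
  unfold invNum
  set τ := Equiv.swap i (i + 1) with hτ
  have hτd : ∀ x, τ x = if x = i then i + 1 else if x = i + 1 then i else x :=
    fun x => Equiv.swap_apply_def _ _ _
  rw [← Finset.card_map (s := (Finset.range (n + 1) ×ˢ Finset.range (n + 1)).filter
    fun p => p.1 < p.2 ∧ σ p.2 < σ p.1) (Equiv.prodCongr τ τ).toEmbedding, ← Finset.card_insert_of_notMem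
    (a := (i, i + 1))]
  · congr 1
    ext ⟨a, b⟩
    have hmem : (a, b) ∈ ((Finset.range (n + 1) ×ˢ Finset.range (n + 1)).filter
        fun p => p.1 < p.2 ∧ σ p.2 < σ p.1).map (Equiv.prodCongr τ τ).toEmbedding ↔
        (τ a < n + 1 ∧ τ b < n + 1) ∧ τ a < τ b ∧ σ (τ b) < σ (τ a) := by
      rw [Finset.mem_map_equiv]
      simp [hτ]
    rw [Finset.mem_insert, hmem, Finset.mem_filter, Finset.mem_product, Finset.mem_range,
      Finset.mem_range, Prod.mk.injEq]
    simp only [Equiv.Perm.mul_apply]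
    have ha := hτd a
    have hb := hτd b
    by_cases e : a = i ∧ b = i + 1
    · obtain ⟨rfl, rfl⟩ := e
      rw [if_pos rfl] at ha
      rw [if_neg (by omega), if_pos rfl] at hb
      simp only [ha, hb, h, and_true, true_or, iff_true]
      omega
    · have e1 : (τ a < n + 1 ∧ τ b < n + 1) ↔ (a < n + 1 ∧ b < n + 1) := by
        rw [ha, hb]; split_ifs <;> omega
      -- The one pair whose order flips here, `(i + 1, i)`, would need `σ (i + 1) < σ i`, against
      -- `h`.
      have e2 : ∀ h' : σ (τ b) < σ (τ a), (τ a < τ b ↔ a < b) := by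
        intro h'
        by_cases e' : a = i + 1 ∧ b = i
        · obtain ⟨rfl, rfl⟩ := e'
          rw [if_neg (by omega), if_pos rfl] at ha
          rw [if_pos rfl] at hb
          rw [ha, hb] at h'
          omega
        · rw [ha, hb]; split_ifs <;> omega
      rw [e1]
      constructor
      · rintro ⟨x, y, z⟩; exact Or.inr ⟨x, (e2 z).mpr y, z⟩
      · rintro (x | ⟨x, y, z⟩)
        · exact absurd x e
        · exact ⟨x, (e2 z).mp y, z⟩
  · rw [Finset.mem_map_equiv]
    simp [hτ]

theorem invNum_mul_swap_le {n : ℕ} (σ : Equiv.Perm ℕ) {i : ℕ} (hi : i < n) :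
    invNum n (σ * Equiv.swap i (i + 1)) ≤ invNum n σ + 1 := by
  rcases lt_or_ge (σ i) (σ (i + 1)) with h | h
  · exact (invNum_mul_swap σ hi h).le
  · have h' : σ (i + 1) < σ i :=
      lt_of_le_of_ne h fun e => by have := σ.injective e; omega
    have := invNum_mul_swap (σ * Equiv.swap i (i + 1)) hi (by simpa using h')
    rw [mul_assoc, Equiv.swap_mul_self, mul_one] at this
    omega

theorem invNum_one (n : ℕ) : invNum n 1 = 0 := by
  unfold invNum
  rw [Finset.card_eq_zero, Finset.filter_eq_empty_iff]
  simp only [Equiv.Perm.one_apply]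
  omega

theorem invNum_permHom_le (w : W) : invNum n (permHom cs w) ≤ cs.length w := by
  obtain ⟨ω, hω, rfl⟩ := cs.exists_isReduced w
  rw [hω.eq]
  clear hω
  induction ω using List.reverseRecOn with
  | nil => simp [invNum_one]
  | append_singleton ω i ih =>
    rw [cs.wordProd_append, cs.wordProd_singleton, List.length_append, List.length_singleton,
      map_mul, ← gen_of_lt cs i.2, permHom_gen cs i.2]
    exact (invNum_mul_swap_le _ i.2).trans (by omega)

end TypeA

/-! ### Type B: relations between the generators -/

section TypeB

variable {m : ℕ} {W : Type*} [Group W] (cs : CoxeterSystem (CoxeterMatrix.B m) W)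

theorem commute_gen_typeB (i j : ℕ) (h : i + 1 < j) : Commute (gen cs i) (gen cs j) := by
  rcases lt_or_ge j m with hj | hj
  · have hi : i < m := by omega
    rw [gen_of_lt cs hj, gen_of_lt cs hi]
    have hM : (CoxeterMatrix.B m) ⟨i, hi⟩ ⟨j, hj⟩ = 2 := by
      simp only [CoxeterMatrix.B, Matrix.of_apply, Fin.mk.injEq]
      rw [if_neg (by omega), if_neg (by omega), if_neg (by omega)]
    have := cs.simple_mul_simple_pow ⟨i, hi⟩ ⟨j, hj⟩
    rw [hM] at this
    exact commute_of_pow_two (by simp) (by simp) this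
  · rw [gen_of_le cs hj]; exact Commute.one_right _

theorem braid_gen_typeB (i : ℕ) (h : i + 2 < m) :
    gen cs i * gen cs (i + 1) * gen cs i = gen cs (i + 1) * gen cs i * gen cs (i + 1) := by
  have hi : i < m := by omega
  have hj : i + 1 < m := by omega
  rw [gen_of_lt cs hj, gen_of_lt cs hi]
  have hM : (CoxeterMatrix.B m) ⟨i, hi⟩ ⟨i + 1, hj⟩ = 3 := by
    simp only [CoxeterMatrix.B, Matrix.of_apply, Fin.mk.injEq]
    rw [if_neg (by omega), if_neg (by omega), if_pos (by simp)]
  have := cs.simple_mul_simple_pow ⟨i, hi⟩ ⟨i + 1, hj⟩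
  rw [hM] at this
  exact mul_pow_three (by simp) (by simp) this

theorem braid_four_gen_typeB (i : ℕ) (h : i + 2 = m) :
    gen cs i * gen cs (i + 1) * gen cs i * gen cs (i + 1) =
      gen cs (i + 1) * gen cs i * gen cs (i + 1) * gen cs i := by
  have hi : i < m := by omega
  have hj : i + 1 < m := by omega
  rw [gen_of_lt cs hj, gen_of_lt cs hi]
  have hM : (CoxeterMatrix.B m) ⟨i, hi⟩ ⟨i + 1, hj⟩ = 4 := by
    simp only [CoxeterMatrix.B, Matrix.of_apply, Fin.mk.injEq]
    rw [if_neg (by omega), if_pos (by omega)]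
  have := cs.simple_mul_simple_pow ⟨i, hi⟩ ⟨i + 1, hj⟩
  rw [hM] at this
  set a := cs.simple ⟨i, hi⟩
  set b := cs.simple ⟨i + 1, hj⟩
  have h1 : (a * b * a * b) * (a * b * a * b) = 1 := by
    rw [← this]; simp only [pow_succ, pow_zero, one_mul, mul_assoc]
  rw [eq_inv_of_mul_eq_one_left h1]
  simp only [mul_inv_rev, a, b, cs.inv_simple, mul_assoc]

end TypeB

/-! ### The folding: action, inversions and lengths -/

section Fold

variable {n : ℕ} {WA WB : Type*} [Group WA] [Group WB]
  (csA : CoxeterSystem (CoxeterMatrix.A n) WA)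
  (csB : CoxeterSystem (CoxeterMatrix.B ((n + 1) / 2)) WB)

theorem foldingHom_gen {i : ℕ} (h : i < (n + 1) / 2) :
    foldingHom csA csB (gen csB i) = foldingGenerator csA ⟨i, h⟩ := by
  rw [gen_of_lt csB h]
  exact csB.lift_apply_simple (isLiftable_foldingGenerator csA) ⟨i, h⟩

theorem foldingHom_gen_of_lt {i : ℕ} (h : i + 1 < (n + 1) / 2) :
    foldingHom csA csB (gen csB i) = gen csA i * gen csA (n - 1 - i) := by
  rw [foldingHom_gen csA csB (by omega), gen_of_lt csA (show i < n by omega),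
    gen_of_lt csA (show n - 1 - i < n by omega)]
  unfold foldingGenerator
  dsimp only
  rw [if_pos h]
  congr 2
  ext
  simp only [Fin.val_rev]
  omega

theorem foldingHom_gen_last_of_odd {i : ℕ} (h : i + 1 = (n + 1) / 2) (hn : Odd n) :
    foldingHom csA csB (gen csB i) = gen csA i := by
  rw [foldingHom_gen csA csB (by omega), gen_of_lt csA (show i < n by omega)]
  unfold foldingGenerator
  dsimp only
  rw [if_neg (by omega), if_pos hn]

theorem foldingHom_gen_last_of_even {i : ℕ} (h : i + 1 = (n + 1) / 2) (hn : ¬ Odd n) :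
    foldingHom csA csB (gen csB i) = gen csA i * gen csA (i + 1) * gen csA i := by
  have := Nat.not_odd_iff.mp hn
  rw [foldingHom_gen csA csB (by omega), gen_of_lt csA (show i < n by omega),
    gen_of_lt csA (show i + 1 < n by omega)]
  unfold foldingGenerator
  dsimp only
  rw [if_neg (by omega), if_neg hn]
  congr 3
  ext
  simp only [Fin.val_rev]
  omega

/-- The action of `B_m` on `{0, …, n} ⊆ ℕ` through the folding homomorphism. -/
noncomputable def foldPerm : WB →* Equiv.Perm ℕ := (permHom csA).comp (foldingHom csA csB)

theorem foldPerm_gen_of_lt {i : ℕ} (h : i + 1 < (n + 1) / 2) :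
    foldPerm csA csB (gen csB i) =
      Equiv.swap i (i + 1) * Equiv.swap (n - 1 - i) (n - 1 - i + 1) := by
  rw [foldPerm, MonoidHom.comp_apply, foldingHom_gen_of_lt csA csB h, map_mul,
    permHom_gen csA (by omega), permHom_gen csA (by omega)]

theorem foldPerm_gen_last_of_odd {i : ℕ} (h : i + 1 = (n + 1) / 2) (hn : Odd n) :
    foldPerm csA csB (gen csB i) = Equiv.swap i (i + 1) := by
  rw [foldPerm, MonoidHom.comp_apply, foldingHom_gen_last_of_odd csA csB h hn,
    permHom_gen csA (by omega)]

theorem foldPerm_gen_last_of_even {i : ℕ} (h : i + 1 = (n + 1) / 2) (hn : ¬ Odd n) :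
    foldPerm csA csB (gen csB i) =
      Equiv.swap i (i + 1) * Equiv.swap (i + 1) (i + 1 + 1) * Equiv.swap i (i + 1) := by
  have := Nat.not_odd_iff.mp hn
  rw [foldPerm, MonoidHom.comp_apply, foldingHom_gen_last_of_even csA csB h hn, map_mul, map_mul,
    permHom_gen csA (by omega), permHom_gen csA (by omega)]

/-- The position reached after `e` steps from the left end of `{0, …, n}`, skipping the central
point if there is one. -/
def foldPoint (n e : ℕ) : ℕ := if e < (n + 1) / 2 then e else e + (n + 1 - 2 * ((n + 1) / 2))

theorem strictMono_foldPoint (n : ℕ) : StrictMono (foldPoint n) := by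
  refine strictMono_nat_of_lt_succ fun e => ?_
  unfold foldPoint
  split_ifs <;> omega

theorem foldPerm_gen_apply_of_lt {i k : ℕ} (hi : i < (n + 1) / 2) (hk : k < i) :
    foldPerm csA csB (gen csB i) k = k := by
  rcases Nat.lt_or_ge (i + 1) ((n + 1) / 2) with h | h
  · rw [foldPerm_gen_of_lt csA csB h]
    simp only [Equiv.Perm.mul_apply, Equiv.swap_apply_def]
    split_ifs <;> omega
  · have h' : i + 1 = (n + 1) / 2 := by omega
    by_cases hn : Odd n
    · rw [foldPerm_gen_last_of_odd csA csB h' hn]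
      simp only [Equiv.swap_apply_def]
      split_ifs <;> omega
    · rw [foldPerm_gen_last_of_even csA csB h' hn]
      simp only [Equiv.Perm.mul_apply, Equiv.swap_apply_def]
      split_ifs <;> omega

/-- The zigzag word moves a point along {0, …, n} one step per letter: first half by the left swaps,
second half by their mirror images, and across the centre by the last generator. -/
theorem foldPerm_gen_foldPoint {e : ℕ} (he : e + 1 < 2 * ((n + 1) / 2)) :
    foldPerm csA csB (gen csB (zigzag ((n + 1) / 2) e)) (foldPoint n (e + 1)) =
      foldPoint n e := by
  rcases lt_trichotomy (e + 1) ((n + 1) / 2) with h | h | h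
  · rw [zigzag_of_lt (by omega), foldPerm_gen_of_lt csA csB h]
    simp only [foldPoint, Equiv.Perm.mul_apply, Equiv.swap_apply_def]
    split_ifs <;> omega
  · rw [zigzag_of_lt (by omega)]
    by_cases hn : Odd n
    · have := Nat.odd_iff.mp hn
      rw [foldPerm_gen_last_of_odd csA csB h hn]
      simp only [foldPoint, Equiv.swap_apply_def]
      split_ifs <;> omega
    · have := Nat.not_odd_iff.mp hn
      rw [foldPerm_gen_last_of_even csA csB h hn]
      simp only [foldPoint, Equiv.Perm.mul_apply, Equiv.swap_apply_def]
      split_ifs <;> omega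
  · rw [zigzag_of_le (by omega), foldPerm_gen_of_lt csA csB (by omega)]
    simp only [foldPoint, Equiv.Perm.mul_apply, Equiv.swap_apply_def]
    split_ifs <;> omega

/-- No group of type A is given here; the standard one attached to the Coxeter matrix supplies the
permutation action that separates the cosets. -/
theorem isTower_typeB :
    IsTower ((n + 1) / 2) (fun k => gen csB '' Set.Ico k ((n + 1) / 2))
      (fun k => 2 * ((n + 1) / 2 - k))
      (chainProd fun e => gen csB (zigzag ((n + 1) / 2) e)) where
  top := closure_image_gen_zero csB
  bot := closure_image_gen_self csB
  chain _ hk := isChain_typeB (gen_mul_self csB) (commute_gen_typeB csB) (braid_gen_typeB csB)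
    (braid_four_gen_typeB csB) (foldPerm (CoxeterMatrix.A n).toCoxeterSystem csB) (foldPoint n)
    (strictMono_foldPoint n) (fun _ h => if_pos h)
    (fun _ hi _ => foldPerm_gen_apply_of_lt (CoxeterMatrix.A n).toCoxeterSystem csB hi)
    (fun _ => foldPerm_gen_foldPoint (CoxeterMatrix.A n).toCoxeterSystem csB) hk

theorem finsum_pow_length_typeB {R : Type*} [CommSemiring R] (x : R) :
    ∑ᶠ w : WB, x ^ csB.length w =
      ∏ i ∈ Finset.range ((n + 1) / 2), ∑ j ∈ Finset.range (2 * (i + 1)), x ^ j := by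
  have ht := isTower_typeB csB
  rw [ht.finsum_pow csB.length csB.length_one (fun _ j => j)
    (ht.length_mul csB (range_simple_eq_image_gen csB).subset
      fun k _ j _ => length_chainProd_le csB _ (fun _ => length_gen_le csB _) k j),
    ← Finset.prod_range_reflect]
  refine Finset.prod_congr rfl fun i hi => ?_
  rw [Finset.mem_range] at hi
  rw [show (n + 1) / 2 - ((n + 1) / 2 - 1 - i) = i + 1 by omega]

/-- A permutation of `{0, …, n}` commuting with `x ↦ n - x`. -/
def IsCentral (n : ℕ) (σ : Equiv.Perm ℕ) : Prop := ∀ x ≤ n, σ x ≤ n ∧ σ (n - x) + σ x = n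

theorem IsCentral.mul {σ τ : Equiv.Perm ℕ} (hσ : IsCentral n σ) (hτ : IsCentral n τ) :
    IsCentral n (σ * τ) := by
  intro x hx
  obtain ⟨h1, h2⟩ := hτ x hx
  obtain ⟨h3, h4⟩ := hσ _ h1
  refine ⟨h3, ?_⟩
  rw [Equiv.Perm.mul_apply, Equiv.Perm.mul_apply, show τ (n - x) = n - τ x by omega]
  exact h4

theorem isCentral_foldPerm_gen {i : ℕ} (hi : i < (n + 1) / 2) :
    IsCentral n (foldPerm csA csB (gen csB i)) := by
  intro x hx
  rcases Nat.lt_or_ge (i + 1) ((n + 1) / 2) with h | h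
  · rw [foldPerm_gen_of_lt csA csB h]
    have h1 : n - 1 - i + 1 = n - i := by omega
    simp only [Equiv.Perm.mul_apply, Equiv.swap_apply_def, h1]
    grind
  · have h' : i + 1 = (n + 1) / 2 := by omega
    by_cases hn : Odd n
    · have := Nat.odd_iff.mp hn
      rw [foldPerm_gen_last_of_odd csA csB h' hn]
      simp only [Equiv.swap_apply_def]
      split_ifs <;> omega
    · have := Nat.not_odd_iff.mp hn
      rw [foldPerm_gen_last_of_even csA csB h' hn]
      simp only [Equiv.Perm.mul_apply, Equiv.swap_apply_def]
      grind

theorem isCentral_foldPerm (v : WB) : IsCentral n (foldPerm csA csB v) := by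
  induction v using csB.simple_induction_right with
  | one => intro x hx; simp only [map_one, Equiv.Perm.one_apply]; omega
  | mul_simple_right w i ih =>
    rw [map_mul]
    refine ih.mul ?_
    rw [← gen_of_lt csB i.2]
    exact isCentral_foldPerm_gen csA csB i.2

theorem foldPerm_apply_of_mem_closure {k : ℕ} {v : WB}
    (hv : v ∈ Subgroup.closure (gen csB '' Set.Ico k ((n + 1) / 2))) {x : ℕ} (hx : x < k) :
    foldPerm csA csB v x = x := by
  have hle : Subgroup.closure (gen csB '' Set.Ico k ((n + 1) / 2)) ≤
      (MulAction.stabilizer (Equiv.Perm ℕ) x).comap (foldPerm csA csB) := by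
    rw [Subgroup.closure_le]
    rintro _ ⟨i, ⟨h1, h2⟩, rfl⟩
    exact foldPerm_gen_apply_of_lt csA csB h2 (by omega)
  exact hle hv

/-- The length in `A_n` of the image of the last generator of `B_m`. -/
def lastWeight (n : ℕ) : ℕ := if Odd n then 1 else 3

/-- The length in `A_n` of the image of a generator of `B_m`. -/
def stepWeight (n e : ℕ) : ℕ := if e + 1 = (n + 1) / 2 then lastWeight n else 2

theorem length_foldingHom_gen_le {e : ℕ} (he : e + 1 < 2 * ((n + 1) / 2)) :
    csA.length (foldingHom csA csB (gen csB (zigzag ((n + 1) / 2) e))) ≤ stepWeight n e := by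
  have two : ∀ i, i + 1 < (n + 1) / 2 → csA.length (foldingHom csA csB (gen csB i)) ≤ 2 := by
    intro i hi
    rw [foldingHom_gen_of_lt csA csB hi]
    exact (csA.length_mul_le _ _).trans
      (Nat.add_le_add (length_gen_le csA _) (length_gen_le csA _))
  unfold stepWeight
  split_ifs with h
  · rw [zigzag_of_lt (by omega)]
    unfold lastWeight
    split_ifs with hn
    · rw [foldingHom_gen_last_of_odd csA csB h hn]
      exact length_gen_le csA _
    · rw [foldingHom_gen_last_of_even csA csB h hn]
      exact (csA.length_mul_le _ _).trans (Nat.add_le_add ((csA.length_mul_le _ _).trans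
        (Nat.add_le_add (length_gen_le csA _) (length_gen_le csA _))) (length_gen_le csA _))
  · apply two
    unfold zigzag
    split_ifs <;> omega

/-- Moving the smallest entry one step to the right, and the largest one step to the left, in a
centrally symmetric permutation. -/
theorem invNum_mul_foldPerm_gen {k e : ℕ} (hk : k ≤ e) (he : e + 1 + k < 2 * ((n + 1) / 2))
    {σ : Equiv.Perm ℕ} (hσ : IsCentral n σ) (hfix : ∀ x < k, σ x = x)
    (hpt : σ (foldPoint n e) = k) :
    invNum n (σ * foldPerm csA csB (gen csB (zigzag ((n + 1) / 2) e))) =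
      invNum n σ + stepWeight n e := by
  -- The values below `k` are taken at the fixed points below `k`, and `k` itself at `foldPoint n
  -- e`.
  have hlt : ∀ y, k ≤ y → y ≠ foldPoint n e → k < σ y := by
    intro y hy hne
    by_contra hcon
    rcases lt_or_eq_of_le (not_lt.mp hcon) with h | h
    · have := σ.injective (hfix _ h)
      omega
    · exact hne (σ.injective (h.trans hpt.symm))
  -- Central symmetry carries an ascent to the mirrored pair of positions.
  have hrev : ∀ x y x' y', x + x' = n → y + y' = n → σ x < σ y → σ y' < σ x' := by
    intro x y x' y' hx hy h
    have h1 := (hσ x (by omega)).2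
    have h2 := (hσ y (by omega)).2
    rw [show n - x = x' by omega] at h1
    rw [show n - y = y' by omega] at h2
    omega
  have two : ∀ i, i + 1 < (n + 1) / 2 → σ i < σ (i + 1) → σ (n - 1 - i) < σ (n - 1 - i + 1) →
      invNum n (σ * foldPerm csA csB (gen csB i)) = invNum n σ + 2 := by
    intro i hi h1 h2
    rw [foldPerm_gen_of_lt csA csB hi, ← mul_assoc, invNum_mul_swap _ (by omega),
      invNum_mul_swap _ (by omega) h1]
    rwa [Equiv.Perm.mul_apply, Equiv.Perm.mul_apply, Equiv.swap_apply_of_ne_of_ne (by omega)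
      (by omega), Equiv.swap_apply_of_ne_of_ne (by omega) (by omega)]
  rcases lt_trichotomy (e + 1) ((n + 1) / 2) with h | h | h
  · have hp : foldPoint n e = e := if_pos (by omega)
    rw [hp] at hpt hlt
    rw [zigzag_of_lt (by omega), stepWeight, if_neg (by omega)]
    have h1 : σ e < σ (e + 1) := by rw [hpt]; exact hlt _ (by omega) (by omega)
    exact two e h h1 (hrev e (e + 1) _ _ (by omega) (by omega) h1)
  · have hp : foldPoint n e = e := if_pos (by omega)
    rw [hp] at hpt hlt
    have h1 : σ e < σ (e + 1) := by rw [hpt]; exact hlt _ (by omega) (by omega)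
    rw [zigzag_of_lt (by omega), stepWeight, if_pos h, lastWeight]
    split_ifs with hn
    · rw [foldPerm_gen_last_of_odd csA csB h hn, invNum_mul_swap _ (by omega) h1]
    · have := Nat.not_odd_iff.mp hn
      -- For even `n` the position `e + 1` is the centre, its own mirror image. Three increasing
      -- values get reversed, which creates three inversions.
      have h2 : σ (e + 1) < σ (e + 1 + 1) :=
        hrev e (e + 1) (e + 1 + 1) (e + 1) (by omega) (by omega) h1
      rw [foldPerm_gen_last_of_even csA csB h hn, ← mul_assoc, ← mul_assoc,
        invNum_mul_swap _ (by omega), invNum_mul_swap _ (by omega),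
        invNum_mul_swap _ (by omega) h1]
      · rw [Equiv.Perm.mul_apply, Equiv.Perm.mul_apply, Equiv.swap_apply_right,
          Equiv.swap_apply_of_ne_of_ne (by omega) (by omega)]
        exact h1.trans h2
      · simp only [Equiv.Perm.mul_apply]
        rw [Equiv.swap_apply_left, Equiv.swap_apply_of_ne_of_ne (a := e + 1) (by omega) (by omega),
          Equiv.swap_apply_left, Equiv.swap_apply_of_ne_of_ne (by omega) (by omega)]
        exact h2
  · have hp : foldPoint n e = e + (n + 1 - 2 * ((n + 1) / 2)) := if_neg (by omega)
    rw [zigzag_of_le (by omega), stepWeight, if_neg (by omega)]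
    obtain ⟨q, hq⟩ : ∃ q, q = 2 * ((n + 1) / 2) - 2 - e := ⟨_, rfl⟩
    -- In the right half the moving entry is carried by the mirror swap, so the ascent is known
    -- there first and reflected to the left.
    have hp' : foldPoint n e = n - 1 - q := by omega
    rw [hp'] at hpt hlt
    have h1 : σ (n - 1 - q) < σ (n - 1 - q + 1) := by
      rw [hpt]; exact hlt _ (by omega) (by omega)
    rw [← hq]
    exact two q (by omega) (hrev _ _ _ _ (by omega) (by omega) h1) h1

/-- The length in `A_n` of the image of the `j`-th coset representative, in a chain of
`2 * M` of them. -/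
def chainWeight (n M j : ℕ) : ℕ := if j < M then 2 * j else 2 * (j - 1) + lastWeight n

theorem chainWeight_succ {k j : ℕ} (hk : k < (n + 1) / 2) :
    chainWeight n ((n + 1) / 2 - k) (j + 1) =
      chainWeight n ((n + 1) / 2 - k) j + stepWeight n (k + j) := by
  unfold chainWeight stepWeight
  split_ifs <;> omega

theorem length_foldingHom_mul_le {k : ℕ} (hk : k < (n + 1) / 2) (h : WB) {j : ℕ}
    (hj : j < 2 * ((n + 1) / 2 - k)) :
    csA.length (foldingHom csA csB
      (h * chainProd (fun e => gen csB (zigzag ((n + 1) / 2) e)) k j)) ≤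
      csA.length (foldingHom csA csB h) + chainWeight n ((n + 1) / 2 - k) j := by
  induction j with
  | zero => simp [chainProd]
  | succ j ih =>
    rw [chainWeight_succ hk]
    simp only [chainProd]
    rw [← mul_assoc, map_mul]
    have := csA.length_mul_le (foldingHom csA csB
      (h * chainProd (fun e => gen csB (zigzag ((n + 1) / 2) e)) k j))
      (foldingHom csA csB (gen csB (zigzag ((n + 1) / 2) (k + j))))
    have := ih (by omega)
    have := length_foldingHom_gen_le csA csB (e := k + j) (by omega)
    omega

theorem foldPerm_chainProd {k : ℕ} (hk : k < (n + 1) / 2) {j : ℕ}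
    (hj : j < 2 * ((n + 1) / 2 - k)) :
    foldPerm csA csB (chainProd (fun e => gen csB (zigzag ((n + 1) / 2) e)) k j)
      (foldPoint n (k + j)) = k := by
  induction j with
  | zero => simp [chainProd, foldPoint, hk]
  | succ j ih =>
    simp only [chainProd, map_mul, Equiv.Perm.mul_apply]
    rw [← add_assoc, foldPerm_gen_foldPoint csA csB (by omega)]
    exact ih (by omega)

/-- Before each letter the permutation fixes all points below `k` and has value `k` at `foldPoint n
(k + j)`, so `invNum_mul_foldPerm_gen` gives the exact gain. -/
theorem invNum_foldPerm_mul {k : ℕ} (hk : k < (n + 1) / 2) {h : WB}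
    (hh : h ∈ Subgroup.closure (gen csB '' Set.Ico (k + 1) ((n + 1) / 2))) {j : ℕ}
    (hj : j < 2 * ((n + 1) / 2 - k)) :
    invNum n (foldPerm csA csB
      (h * chainProd (fun e => gen csB (zigzag ((n + 1) / 2) e)) k j)) =
      invNum n (foldPerm csA csB h) + chainWeight n ((n + 1) / 2 - k) j := by
  have hc := (isTower_typeB csB).chain k hk
  induction j with
  | zero => simp only [chainProd, chainWeight, mul_one]; rw [if_pos (by omega)]; rfl
  | succ j ih =>
    rw [chainWeight_succ hk, ← add_assoc, ← ih (by omega)]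
    conv_lhs => rw [chainProd, ← mul_assoc, map_mul]
    refine invNum_mul_foldPerm_gen csA csB (by omega) (by omega) (isCentral_foldPerm csA csB _)
      (fun x hx => ?_) ?_ (k := k)
    · exact foldPerm_apply_of_mem_closure csA csB
        (mul_mem (hc.closure_le hh) (hc.mem j (by omega))) hx
    · rw [map_mul, Equiv.Perm.mul_apply, foldPerm_chainProd csA csB hk (by omega)]
      exact foldPerm_apply_of_mem_closure csA csB hh (by omega)

/-- Inversions bound the length from below. Along the normal form the length gains at most
`chainWeight` while inversions gain exactly that, which forces equality. -/
theorem length_foldingHom (v : WB) :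
    csA.length (foldingHom csA csB v) = invNum n (foldPerm csA csB v) := by
  refine le_antisymm ?_ (invNum_permHom_le csA _)
  exact (isTower_typeB csB).le_of_chain (f := fun v => csA.length (foldingHom csA csB v))
    (g := fun v => invNum n (foldPerm csA csB v)) (by simp)
    (fun k j => chainWeight n ((n + 1) / 2 - k) j)
    (fun k hk h _ j hj => length_foldingHom_mul_le csA csB hk h hj)
    (fun k hk h hh j hj => (invNum_foldPerm_mul csA csB hk hh hj).ge) v

/-- The j-th representative has length at most `j`, and `chainWeight` is at least `j`. -/
theorem length_le_length_foldingHom (v : WB) :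
    csB.length v ≤ csA.length (foldingHom csA csB v) := by
  have ht := isTower_typeB csB
  refine ht.le_of_chain (f := csB.length) (g := fun v => csA.length (foldingHom csA csB v))
    (by simp) (fun _ j => j) ?_ ?_ v
  · intro k _ h _ j _
    exact (csB.length_mul_le _ _).trans (Nat.add_le_add_left
      (length_chainProd_le csB _ (fun _ => length_gen_le csB _) k j) _)
  · intro k hk h hh j hj
    rw [length_foldingHom, length_foldingHom, invNum_foldPerm_mul csA csB hk hh hj]
    unfold chainWeight lastWeight
    split_ifs <;> omega

theorem foldingHom_injective : Function.Injective (foldingHom csA csB) := by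
  rw [injective_iff_map_eq_one]
  intro v hv
  have := length_le_length_foldingHom csA csB v
  rw [hv, csA.length_one] at this
  exact csB.length_eq_zero_iff.mp (by omega)

/-- The second half of the chain repeats the weights of the first, shifted by `2 * i + lastWeight
n`. -/
theorem sum_pow_chainWeight {R : Type*} [CommSemiring R] (x : R) (i : ℕ) :
    ∑ j ∈ Finset.range (2 * (i + 1)), x ^ chainWeight n (i + 1) j =
      (1 + x ^ (2 * i + lastWeight n)) * ∑ j ∈ Finset.range (i + 1), x ^ (2 * j) := by
  rw [two_mul, Finset.sum_range_add, add_mul, one_mul, Finset.mul_sum]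
  congr 1
  · refine Finset.sum_congr rfl fun j hj => ?_
    rw [chainWeight, if_pos (Finset.mem_range.mp hj)]
  · refine Finset.sum_congr rfl fun j _ => ?_
    rw [chainWeight, if_neg (by omega), ← pow_add]
    congr 1
    omega

theorem finsum_pow_length_foldingHom {R : Type*} [CommSemiring R] (x : R) :
    ∑ᶠ v : WB, x ^ csA.length (foldingHom csA csB v) =
      ∏ i ∈ Finset.range ((n + 1) / 2),
        ((1 + x ^ (2 * i + lastWeight n)) * ∑ j ∈ Finset.range (i + 1), x ^ (2 * j)) := by
  rw [(isTower_typeB csB).finsum_pow (fun v => csA.length (foldingHom csA csB v)) (by simp)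
    (fun k j => chainWeight n ((n + 1) / 2 - k) j), ← Finset.prod_range_reflect]
  · refine Finset.prod_congr rfl fun i hi => ?_
    rw [Finset.mem_range] at hi
    rw [show (n + 1) / 2 - ((n + 1) / 2 - 1 - i) = i + 1 by omega, sum_pow_chainWeight]
  · intro k hk h hh j hj
    rw [length_foldingHom, length_foldingHom, invNum_foldPerm_mul csA csB hk hh hj]

end Fold

/-! ### The polynomial identity -/

section Identity

variable {R : Type*} [CommRing R]

theorem geom_sum_two_mul (x : R) (i : ℕ) :
    ∑ j ∈ Finset.range (2 * i), x ^ j = (1 + x) * ∑ j ∈ Finset.range i, x ^ (2 * j) := by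
  induction i with
  | zero => simp
  | succ i ih =>
    rw [show 2 * (i + 1) = 2 * i + 1 + 1 by ring, Finset.sum_range_succ, Finset.sum_range_succ, ih,
      Finset.sum_range_succ]
    ring

theorem one_add_mul_geom_sum_neg (x : R) (i : ℕ) :
    (1 + x) * ∑ j ∈ Finset.range (2 * i + 1), (-x) ^ j = 1 + x ^ (2 * i + 1) := by
  have := mul_neg_geom_sum (-x) (2 * i + 1)
  rw [sub_neg_eq_add, Odd.neg_pow ⟨i, rfl⟩, sub_neg_eq_add] at this
  exact this

theorem prod_range_even (f : ℕ → R) (m : ℕ) :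
    ∏ i ∈ Finset.range (2 * m), f i =
      ∏ i ∈ Finset.range m, (f (2 * i) * f (2 * i + 1)) := by
  induction m with
  | zero => simp
  | succ m ih =>
    rw [show 2 * (m + 1) = 2 * m + 1 + 1 by ring, Finset.prod_range_succ, Finset.prod_range_succ,
      ih, Finset.prod_range_succ, mul_assoc]

/-- The Poincaré polynomial of `A_n` at `y`, its factors grouped in pairs. -/
theorem prod_geom_sum_pairs (y : R) (n : ℕ) :
    ∏ i ∈ Finset.range n, ∑ j ∈ Finset.range (i + 2), y ^ j =
      ∏ i ∈ Finset.range ((n + 1) / 2), ((∑ j ∈ Finset.range (2 * (i + 1)), y ^ j) *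
        ∑ j ∈ Finset.range (2 * i + lastWeight n), y ^ j) := by
  rcases Nat.even_or_odd' n with ⟨m, rfl | rfl⟩
  · rw [prod_range_even, show (2 * m + 1) / 2 = m by omega]
    refine Finset.prod_congr rfl fun i _ => ?_
    rw [lastWeight, if_neg (by simp), show 2 * (i + 1) = 2 * i + 2 by ring,
      show 2 * i + 1 + 2 = 2 * i + 3 by ring]
  -- For odd `n` the trivial factor with one term is added in front, so that the number of factors
  -- becomes even.
  · have h := prod_range_even (fun i => ∑ j ∈ Finset.range (i + 1), y ^ j) (m + 1)
    rw [show 2 * (m + 1) = 2 * m + 1 + 1 by ring, Finset.prod_range_succ'] at h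
    simp only [zero_add, Finset.sum_range_one, pow_zero, mul_one] at h
    rw [h, show (2 * m + 1 + 1) / 2 = m + 1 by omega]
    refine Finset.prod_congr rfl fun i _ => ?_
    rw [lastWeight, if_pos (by simp), mul_comm, show 2 * (i + 1) = 2 * i + 1 + 1 by ring]

/-- Factorwise, the sum of 2(i+1) powers of -x is common to both sides; what remains is to move 1+x
from one factor to the other. -/
theorem poincare_identity (x : R) (n : ℕ) :
    (∏ i ∈ Finset.range ((n + 1) / 2), ∑ j ∈ Finset.range (2 * (i + 1)), (-x) ^ j) *
      ∏ i ∈ Finset.range ((n + 1) / 2),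
        ((1 + x ^ (2 * i + lastWeight n)) * ∑ j ∈ Finset.range (i + 1), x ^ (2 * j)) =
    (∏ i ∈ Finset.range n, ∑ j ∈ Finset.range (i + 2), (-x) ^ j) *
      ∏ i ∈ Finset.range ((n + 1) / 2), ∑ j ∈ Finset.range (2 * (i + 1)), x ^ j := by
  rw [prod_geom_sum_pairs, ← Finset.prod_mul_distrib, ← Finset.prod_mul_distrib]
  refine Finset.prod_congr rfl fun i _ => ?_
  have h : (1 + x) * ∑ j ∈ Finset.range (2 * i + lastWeight n), (-x) ^ j =
      1 + x ^ (2 * i + lastWeight n) := by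
    unfold lastWeight
    split_ifs
    · exact one_add_mul_geom_sum_neg x i
    -- Weight 3: 2i + 3 = 2(i + 1) + 1.
    · exact one_add_mul_geom_sum_neg x (i + 1)
  rw [← h, geom_sum_two_mul x]
  ring

end Identity

/-- The sign is absorbed by evaluating the first factor at -X. -/
theorem finsum_neg_one_pow_mul_X_pow {α β : Type*} [Finite α] [Finite β] (a : α → ℕ) (b : β → ℕ) :
    ∑ᶠ p : α × β, (-1 : Polynomial ℤ) ^ a p.1 * Polynomial.X ^ (a p.1 + b p.2) =
      (∑ᶠ x, (-Polynomial.X : Polynomial ℤ) ^ a x) * ∑ᶠ y, (Polynomial.X : Polynomial ℤ) ^ b y := by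
  have := Fintype.ofFinite α
  have := Fintype.ofFinite β
  simp only [finsum_eq_sum_of_fintype]
  rw [Fintype.sum_prod_type, Finset.sum_mul_sum]
  refine Finset.sum_congr rfl fun x _ => Finset.sum_congr rfl fun y _ => ?_
  rw [neg_pow (Polynomial.X : Polynomial ℤ), pow_add, mul_assoc]

end Folding

theorem corollary1p4 (n : ℕ) {WA WB : Type*} [Group WA] [Group WB]
    (csA : CoxeterSystem (CoxeterMatrix.A n) WA)
    (csB : CoxeterSystem (CoxeterMatrix.B ((n + 1) / 2)) WB) :
    Finite WA ∧ Finite WB ∧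
    Function.Injective (Folding.foldingHom csA csB) ∧
    ∑ᶠ p : WB × WB, (-1 : Polynomial ℤ) ^ csB.length p.2 *
        Polynomial.X ^ (csB.length p.2 + csA.length (Folding.foldingHom csA csB p.1)) =
      ∑ᶠ p : WA × WB, (-1 : Polynomial ℤ) ^ csA.length p.1 *
        Polynomial.X ^ (csA.length p.1 + csB.length p.2) := by
  have hA : Finite WA := (Folding.isTower_typeA csA).finite
  have hB : Finite WB := (Folding.isTower_typeB csB).finite
  refine ⟨hA, hB, Folding.foldingHom_injective csA csB, ?_⟩
  rw [Folding.finsum_neg_one_pow_mul_X_pow csA.length csB.length,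
    -- On the left-hand side the sign sits on the second coordinate, hence the exchange.
    ← finsum_comp_equiv (Equiv.prodComm WB WB)]
  refine (Folding.finsum_neg_one_pow_mul_X_pow csB.length
    fun v => csA.length (Folding.foldingHom csA csB v)).trans ?_
  rw [Folding.finsum_pow_length_typeA, Folding.finsum_pow_length_typeB csB,
    Folding.finsum_pow_length_typeB csB, Folding.finsum_pow_length_foldingHom,
    Folding.poincare_identity]
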